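/- Let $k$ be a positive integer and let $\varepsilon_1,\ldots,\varepsilon_k$ be nonnegative real numbers with $\varepsilon_1+\cdots+\varepsilon_k=1$. Let $G$ be a finite graph, possibly with loops and multiple edges, in which every vertex has even degree (a loop contributes $2$ to the degree of its vertex). Then $G$ can be edge-decomposed into $k$ even factors $G_1,\ldots,G_k$; that is, there are spanning subgraphs $G_1,\ldots,G_k$ of $G$, each with all degrees even, whose edge sets are pairwise disjoint (possibly empty) and have union $E(G)$, such that for each $i\in\{1,\ldots,k\}$ and each vertex $v$ of $G_i$, $$|d_{G_i}(v)-\varepsilon_i\, d_G(v)|<6.$$ -/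

import Mathlib

namespace Graph

/-- The degree of `v` in the multigraph `G` (finite): the number of non-loop edges at `v`
plus twice the number of loops at `v`. -/
noncomputable def degree {α β : Type*} (G : Graph α β) (v : α) : ℕ :=
  {e : β | G.IsNonloopAt e v}.ncard + 2 * {e : β | G.IsLoopAt e v}.ncard

/-- All vertices of `G` have even degree. -/
def HasEvenDegrees {α β : Type*} (G : Graph α β) : Prop :=
  ∀ v ∈ G.vertexSet, Even (G.degree v)

/-- A factor of `G` is a spanning subgraph of `G`; it is an even factor if all of its degrees
are even. -/
def IsEvenFactor {α β : Type*} (F G : Graph α β) : Prop :=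
  F.IsSpanningSubgraph G ∧ F.HasEvenDegrees

/-- The subgraphs `H i` decompose the edges of `G`: their edge sets partition the edge set of `G`
(parts may be empty). -/
def IsEdgeDecomposition {α β ι : Type*} (G : Graph α β) (H : ι → Graph α β) : Prop :=
  (∀ i, H i ≤ G) ∧ (∀ i j, i ≠ j → Disjoint (H i).edgeSet (H j).edgeSet) ∧
    ⋃ i, (H i).edgeSet = G.edgeSet

end Graph

/-!
Let `w` be the weights of the colours. The decomposition is built along a binary tree of groups of
colours: at each node an even edge set is split, in the ratio of the weights of the two subgroups,
into two even edge sets.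

*One splitting.* An even edge set contains an even subset whose degrees are within `2` of `ρ` times
the original ones (`EvenEdges.exists_ratio`). For `ρ = 1/2` the error in the difference of the two
parts is at most `2` (`EvenEdges.exists_half`), which follows from two applications of the existence
of Eulerian orientations (`exists_balanced_sign`). For dyadic `ρ` the binary digits of `ρ` are
rounded off from the last one up, each by a halving, so that the errors form a geometric series
(`EvenEdges.exists_round`); a general `ρ` is a limit of dyadic ones.

*The tree.* The error for the colour `i` is at most twice the sum of `w i / w(A)` over the groups
`A` that contain `i`, apart from the root. The tree has to keep this sum below `3` for all `i`. For
a tree with colour set `S` let `τ` be such that the sum, including the root, is at most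
`3 - τ * w i`; this is what `Shares` records. A single colour has `τ = 2 / w i`, and joining two
trees with the same `τ` gives `τ - 1 / w(S ∪ T)` (`Shares.union`). It suffices to join all colours
with `τ > 0`, and a greedy choice achieves this (`Shares.exists_biUnion`): trees with
`τ = 2 / w(S)` are joined as long as their weights differ by a factor of at most two, and otherwise
the lightest of them is joined to one exceptional tree.
-/

/-! ### Balanced signings of half-edges -/

/-- An Eulerian orientation, in terms of half-edges: `a` pairs the half-edges in `H` into edges and
`f` sends a half-edge to its vertex. If all fibres of `f` are even, the half-edges can be given signs
that are opposite on the two halves of each edge and cancel at each vertex. In the induction two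
half-edges `h`, `h'` at a common vertex are removed and their partners are joined to a new edge. -/
theorem exists_balanced_sign {T V : Type*} [DecidableEq T] [DecidableEq V] (f : T → V)
    (H : Finset T) (a : T → T) (ha : ∀ h ∈ H, a h ∈ H) (hne : ∀ h ∈ H, a h ≠ h)
    (haa : ∀ h ∈ H, a (a h) = h) (hev : ∀ v, Even (H.filter (fun h => f h = v)).card) :
    ∃ c : T → ℤ, (∀ h ∈ H, c h = 1 ∨ c h = -1) ∧ (∀ h ∈ H, c (a h) = -c h) ∧
      ∀ v, ∑ h ∈ H with f h = v, c h = 0 := by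
  induction H using Finset.strongInduction generalizing a with
  | H H ih =>
  rcases H.eq_empty_or_nonempty with rfl | ⟨h, hh⟩
  · exact ⟨fun _ => 1, by simp⟩
  obtain ⟨h', hh', hfh', hne'⟩ : ∃ h' ∈ H, f h' = f h ∧ h' ≠ h := by
    by_contra! hcon
    have : H.filter (fun x => f x = f h) = {h} := by
      ext x
      simp only [Finset.mem_filter, Finset.mem_singleton]
      exact ⟨fun hx => hcon x hx.1 hx.2, by rintro rfl; exact ⟨hh, rfl⟩⟩
    have h1 := hev (f h)
    rw [this] at h1
    simp at h1
  obtain ⟨K, hK⟩ : ∃ K, K = (H.erase h).erase h' := ⟨_, rfl⟩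
  have memK : ∀ x, x ∈ K ↔ x ≠ h' ∧ x ≠ h ∧ x ∈ H := by simp [hK]
  have hHK : H = insert h (insert h' K) := by
    ext x
    simp only [Finset.mem_insert, memK]
    by_cases h1 : x = h <;> by_cases h2 : x = h' <;> simp_all
  have hhK : h ∉ insert h' K := by simp [memK, hne'.symm]
  have hh'K : h' ∉ K := by simp [memK]
  have hKH : K ⊂ H := by
    refine ⟨fun x hx => ((memK x).1 hx).2.2, fun hs => hh'K (hs hh')⟩
  have hsum : ∀ (g : T → ℤ) v, ∑ x ∈ H with f x = v, g x
      = (if f h = v then g h + g h' else 0) + ∑ x ∈ K with f x = v, g x := by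
    intro g v
    rw [Finset.sum_filter, Finset.sum_filter, hHK, Finset.sum_insert hhK, Finset.sum_insert hh'K,
      hfh']
    split_ifs <;> ring
  have hevK : ∀ v, Even (K.filter (fun x => f x = v)).card := by
    intro v
    have h1 := hsum (fun _ => 1) v
    have h2 := hev v
    simp only [Finset.sum_const, nsmul_eq_mul, mul_one] at h1
    split_ifs at h1 <;> grind
  by_cases hah : a h = h'
  · have hah' : a h' = h := by rw [← hah, haa h hh]
    obtain ⟨c, hc1, hc2, hc3⟩ := ih K hKH a
      (fun x hx => by
        have hx' := (memK x).1 hx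
        refine (memK _).2 ⟨?_, ?_, ha x hx'.2.2⟩
        · intro h1
          have := haa x hx'.2.2
          rw [h1, hah'] at this
          exact hx'.2.1 this.symm
        · intro h1
          have := haa x hx'.2.2
          rw [h1, hah] at this
          exact hx'.1 this.symm)
      (fun x hx => hne x ((memK x).1 hx).2.2) (fun x hx => haa x ((memK x).1 hx).2.2) hevK
    have hcK : ∀ x ∈ K, (if x = h then 1 else if x = h' then -1 else c x) = c x := by
      intro x hx
      have hx' := (memK x).1 hx
      simp [hx'.1, hx'.2.1]
    refine ⟨fun x => if x = h then 1 else if x = h' then -1 else c x, ?_, ?_, ?_⟩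
    · intro x hx
      grind
    · intro x hx
      by_cases h1 : x = h
      · simp [h1, hah, hne']
      by_cases h2 : x = h'
      · simp [h2, hah', hne']
      have hxK := (memK x).2 ⟨h2, h1, hx⟩
      have h3 : a x ≠ h := fun h3 => h2 (by rw [← haa x hx, h3, hah])
      have h4 : a x ≠ h' := fun h4 => h1 (by rw [← haa x hx, h4, hah'])
      simp only [h1, h2, h3, h4, if_false]
      exact hc2 x hxK
    · intro v
      rw [hsum, Finset.sum_congr rfl (fun x hx => hcK x (Finset.mem_filter.1 hx).1), hc3]
      simp [hne']
  · have hah' : a h' ≠ h := fun h1 => hah (by rw [← h1, haa h' hh'])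
    have haK : a h ∈ K := (memK _).2 ⟨hah, hne h hh, ha h hh⟩
    have haK' : a h' ∈ K := (memK _).2 ⟨hne h' hh', hah', ha h' hh'⟩
    have hinj : a h ≠ a h' := fun h1 => hne' (by rw [← haa h hh, h1, haa h' hh'])
    have hax : ∀ x ∈ K, x ≠ a h → x ≠ a h' → a x ∈ K ∧ a x ≠ a h ∧ a x ≠ a h' := by
      intro x hx h1 h2
      have hx' := (memK x).1 hx
      refine ⟨(memK _).2 ⟨?_, ?_, ha x hx'.2.2⟩, ?_, ?_⟩
      · intro h3; exact h2 (by rw [← h3, haa x hx'.2.2])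
      · intro h3; exact h1 (by rw [← h3, haa x hx'.2.2])
      · intro h3; exact hx'.2.1 (by rw [← haa x hx'.2.2, h3, haa h hh])
      · intro h3; exact hx'.1 (by rw [← haa x hx'.2.2, h3, haa h' hh'])
    obtain ⟨c, hc1, hc2, hc3⟩ := ih K hKH
      (fun x => if x = a h then a h' else if x = a h' then a h else a x)
      (fun x hx => by
        have := hax x hx
        split_ifs <;> tauto)
      (fun x hx => by
        have := hne x ((memK x).1 hx).2.2
        split_ifs with h1 h2
        · rw [h1]; exact hinj.symm
        · rw [h2]; exact hinj
        · exact this)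
      (fun x hx => by
        have h3 := hax x hx
        have h4 := haa x ((memK x).1 hx).2.2
        by_cases h1 : x = a h
        · simp [h1, hinj.symm]
        by_cases h2 : x = a h'
        · simp [h2, hinj.symm]
        obtain ⟨-, h5, h6⟩ := h3 h1 h2
        simp [h1, h2, h5, h6, h4]) hevK
    have hcc : c (a h') = - c (a h) := by simpa using hc2 (a h) haK
    have hcK : ∀ x ∈ K, (if x = h then - c (a h) else if x = h' then - c (a h') else c x) = c x := by
      intro x hx
      have hx' := (memK x).1 hx
      simp [hx'.1, hx'.2.1]
    refine ⟨fun x => if x = h then - c (a h) else if x = h' then - c (a h') else c x, ?_, ?_, ?_⟩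
    · intro x hx
      have h1 := hc1 _ haK
      have h2 := hc1 _ haK'
      by_cases h3 : x = h
      · rcases h1 with h1 | h1 <;> simp [h3, h1]
      by_cases h4 : x = h'
      · rcases h2 with h2 | h2 <;> simp [h4, h2, hne']
      simpa [h3, h4] using hc1 x ((memK x).2 ⟨h4, h3, hx⟩)
    · intro x hx
      by_cases h1 : x = h
      · simp [h1, hah, hne h hh]
      by_cases h2 : x = h'
      · simp [h2, hah', hne h' hh', hne']
      have hxK := (memK x).2 ⟨h2, h1, hx⟩
      by_cases h3 : x = a h
      · subst h3
        simp [haa h hh, h1, h2]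
      by_cases h4 : x = a h'
      · subst h4
        simp [haa h' hh', h1, h2, hne']
      obtain ⟨h5, -, -⟩ := hax x hxK h3 h4
      have h6 := (memK _).1 h5
      simp only [h1, h2, h6.1, h6.2.1, if_false]
      simpa [h3, h4] using hc2 x hxK
    · intro v
      rw [hsum, Finset.sum_congr rfl (fun x hx => hcK x (Finset.mem_filter.1 hx).1), hc3]
      simp [hne', hcc]

/-! ### Halving an even edge set -/

open Classical in
/-- The degree of `v` in the multigraph with edge set `X` whose edge `e` has the ends `ends e false`
and `ends e true`; a loop counts twice. -/
noncomputable def edgeDegree {V β : Type*} (ends : β → Bool → V) (X : Finset β) (v : V) : ℕ :=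
  ∑ e ∈ X, ∑ b : Bool, if ends e b = v then 1 else 0

/-- The edge set `X` is even: all vertices have even degree in it. -/
def EvenEdges {V β : Type*} (ends : β → Bool → V) (X : Finset β) : Prop :=
  ∀ v, Even (edgeDegree ends X v)

theorem edgeDegree_union {V β : Type*} [DecidableEq β] (ends : β → Bool → V) {X Y : Finset β}
    (h : Disjoint X Y) (v : V) :
    edgeDegree ends (X ∪ Y) v = edgeDegree ends X v + edgeDegree ends Y v :=
  Finset.sum_union h

theorem edgeDegree_sdiff {V β : Type*} [DecidableEq β] (ends : β → Bool → V) {X Y : Finset β}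
    (h : Y ⊆ X) (v : V) :
    edgeDegree ends (X \ Y) v + edgeDegree ends Y v = edgeDegree ends X v :=
  Finset.sum_sdiff h

theorem EvenEdges.sdiff {V β : Type*} [DecidableEq β] {ends : β → Bool → V} {X Y : Finset β}
    (hX : EvenEdges ends X) (hY : EvenEdges ends Y) (h : Y ⊆ X) : EvenEdges ends (X \ Y) := by
  intro v
  have h1 := edgeDegree_sdiff ends h v
  have h2 := hX v
  rw [← h1, Nat.even_add] at h2
  exact h2.2 (hY v)

theorem EvenEdges.union {V β : Type*} [DecidableEq β] {ends : β → Bool → V} {X Y : Finset β}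
    (hX : EvenEdges ends X) (hY : EvenEdges ends Y) (h : Disjoint X Y) :
    EvenEdges ends (X ∪ Y) := by
  intro v
  rw [edgeDegree_union ends h]
  exact (hX v).add (hY v)

/-- An even edge set splits into two even edge sets whose degrees differ by at most two. The signs
`c` orient the edges; at each vertex outgoing half-edges are matched with outgoing ones and incoming
with incoming ones, up to one mixed pair. A second signing `t`, balanced for this refined incidence,
makes `t * c` constant on edges, opposite on the pure pairs and equal on the mixed pairs. -/
theorem EvenEdges.exists_half {V β : Type*} [DecidableEq β] {ends : β → Bool → V} {X : Finset β}
    (hX : EvenEdges ends X) :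
    ∃ Y ⊆ X, EvenEdges ends Y ∧
      ∀ v, |2 * (edgeDegree ends Y v : ℤ) - (edgeDegree ends X v : ℤ)| ≤ 2 := by
  classical
  set H : Finset (β × Bool) := X ×ˢ Finset.univ with hH
  set f : β × Bool → V := fun h => ends h.1 h.2 with hf
  set a : β × Bool → β × Bool := fun h => (h.1, !h.2) with ha
  have hdeg : ∀ Y : Finset β, ∀ v,
      edgeDegree ends Y v = ((Y ×ˢ Finset.univ).filter (fun h => f h = v)).card := by
    intro Y v
    rw [edgeDegree, Finset.card_filter, Finset.sum_product]
  have haH : ∀ h ∈ H, a h ∈ H := by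
    intro h hh
    simpa [hH, ha] using hh
  have hne : ∀ h ∈ H, a h ≠ h := by
    rintro ⟨e, b⟩ -
    simp [ha]
  have haa : ∀ h ∈ H, a (a h) = h := by
    rintro ⟨e, b⟩ -
    simp [ha]
  obtain ⟨c, hc1, hc2, hc3⟩ := exists_balanced_sign f H a haH hne haa
    (fun v => by rw [← hdeg]; exact hX v)
  set O : V → Finset (β × Bool) := fun v => (H.filter (fun h => f h = v)).filter (fun h => c h = 1)
  set I : V → Finset (β × Bool) := fun v => (H.filter (fun h => f h = v)).filter (fun h => c h = -1)
  have hOI : ∀ v, H.filter (fun h => f h = v) = O v ∪ I v := by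
    intro v
    rw [← Finset.filter_or]
    exact (Finset.filter_true_of_mem fun h hh => hc1 h (Finset.mem_filter.1 hh).1).symm
  have hdisj : ∀ v, Disjoint (O v) (I v) := by
    intro v
    rw [Finset.disjoint_filter]
    intro h _ h1 h2
    omega
  have hsumO : ∀ v (s : Finset (β × Bool)), s ⊆ O v → ∑ h ∈ s, c h = s.card := by
    intro v s hs
    rw [Finset.sum_congr rfl (fun h hh => (Finset.mem_filter.1 (hs hh)).2)]
    simp
  have hsumI : ∀ v (s : Finset (β × Bool)), s ⊆ I v → ∑ h ∈ s, c h = -s.card := by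
    intro v s hs
    rw [Finset.sum_congr rfl (fun h hh => (Finset.mem_filter.1 (hs hh)).2)]
    simp
  have hcard : ∀ v, (O v).card = (I v).card := by
    intro v
    have h1 := hc3 v
    rw [hOI, Finset.sum_union (hdisj v), hsumO v _ subset_rfl, hsumI v _ subset_rfl] at h1
    omega
  -- the mixed pair at `v`, present when the number of outgoing half-edges at `v` is odd
  have hM : ∀ v, ∃ M : Finset (β × Bool), (M = ∅ ∧ Even (O v).card) ∨
      ∃ o ∈ O v, ∃ i ∈ I v, M = {o, i} ∧ Odd (O v).card := by
    intro v
    rcases Nat.even_or_odd (O v).card with h | h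
    · exact ⟨∅, Or.inl ⟨rfl, h⟩⟩
    · obtain ⟨o, ho⟩ := Finset.card_pos.1 h.pos
      obtain ⟨i, hi⟩ := Finset.card_pos.1 (hcard v ▸ h.pos)
      exact ⟨{o, i}, Or.inr ⟨o, ho, i, hi, rfl, h⟩⟩
  choose M hM using hM
  have hMsub : ∀ v, M v ⊆ H.filter (fun h => f h = v) := by
    intro v
    rw [hOI]
    rcases hM v with ⟨h, -⟩ | ⟨o, ho, i, hi, h, -⟩
    · simp [h]
    · rw [h]
      intro x hx
      rw [Finset.mem_insert, Finset.mem_singleton] at hx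
      rcases hx with rfl | rfl
      · exact Finset.mem_union_left _ ho
      · exact Finset.mem_union_right _ hi
  set f' : β × Bool → V × ℤ := fun h => if h ∈ M (f h) then (f h, 0) else (f h, c h) with hf'
  have hfib0 : ∀ v, H.filter (fun h => f' h = (v, 0)) = M v := by
    intro v
    ext h
    have h1 := @hMsub v h
    have h2 := hc1 h
    grind
  have hfib1 : ∀ v, H.filter (fun h => f' h = (v, 1)) = O v \ M v := by
    intro v
    ext h
    simp only [O, Finset.mem_filter, Finset.mem_sdiff, hf']
    grind
  have hfib2 : ∀ v, H.filter (fun h => f' h = (v, -1)) = I v \ M v := by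
    intro v
    ext h
    simp only [I, Finset.mem_filter, Finset.mem_sdiff, hf']
    grind
  have hOM : ∀ v, Even (O v \ M v).card ∧ Even (I v \ M v).card := by
    intro v
    rcases hM v with ⟨h, h'⟩ | ⟨o, ho, i, hi, h, h'⟩
    · rw [h, Finset.sdiff_empty, Finset.sdiff_empty, ← hcard v]
      exact ⟨h', h'⟩
    · have hoI : o ∉ I v := Finset.disjoint_left.1 (hdisj v) ho
      have hiO : i ∉ O v := Finset.disjoint_right.1 (hdisj v) hi
      have h1 : O v \ M v = (O v).erase o := by
        rw [h]; ext x; simp only [Finset.mem_sdiff, Finset.mem_insert, Finset.mem_singleton,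
          Finset.mem_erase]; grind
      have h2 : I v \ M v = (I v).erase i := by
        rw [h]; ext x; simp only [Finset.mem_sdiff, Finset.mem_insert, Finset.mem_singleton,
          Finset.mem_erase]; grind
      rw [h1, h2, Finset.card_erase_of_mem ho, Finset.card_erase_of_mem hi, ← hcard v]
      have : Even ((O v).card - 1) := Nat.Odd.sub_odd h' odd_one
      exact ⟨this, this⟩
  have hMc : ∀ v, Even (M v).card := by
    intro v
    rcases hM v with ⟨h, -⟩ | ⟨o, ho, i, hi, h, -⟩
    · simp [h]
    · have : o ≠ i := fun hoi => Finset.disjoint_left.1 (hdisj v) ho (hoi ▸ hi)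
      rw [h, Finset.card_pair this]
      exact even_two
  obtain ⟨t, ht1, ht2, ht3⟩ := exists_balanced_sign f' H a haH hne haa (by
    rintro ⟨v, z⟩
    by_cases h0 : z = 0
    · rw [h0, hfib0]; exact hMc v
    by_cases h1 : z = 1
    · rw [h1, hfib1]; exact (hOM v).1
    by_cases h2 : z = -1
    · rw [h2, hfib2]; exact (hOM v).2
    rw [Finset.filter_false_of_mem]
    · simp
    · intro h hh
      have := hc1 h hh
      simp only [hf']
      grind)
  have hs : ∀ h ∈ H, t h * c h = 1 ∨ t h * c h = -1 := by
    intro h hh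
    rcases ht1 h hh with h1 | h1 <;> rcases hc1 h hh with h2 | h2 <;> simp [h1, h2]
  have hsa : ∀ h ∈ H, t (a h) * c (a h) = t h * c h := by
    intro h hh
    rw [ht2 h hh, hc2 h hh]; ring
  have hsv : ∀ v, ∑ h ∈ H with f h = v, t h * c h = ∑ h ∈ M v, t h * c h := by
    intro v
    have h1 : H.filter (fun h => f h = v) = M v ∪ ((O v \ M v) ∪ (I v \ M v)) := by
      rw [← Finset.union_sdiff_distrib, ← hOI, Finset.union_sdiff_of_subset (hMsub v)]
    have h2 : Disjoint (M v) ((O v \ M v) ∪ (I v \ M v)) := by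
      rw [← Finset.union_sdiff_distrib]; exact Finset.disjoint_sdiff
    have h3 : Disjoint (O v \ M v) (I v \ M v) :=
      (hdisj v).mono Finset.sdiff_subset Finset.sdiff_subset
    have h4 : ∑ h ∈ O v \ M v, t h * c h = 0 := by
      have h5 := ht3 (v, 1)
      rw [hfib1] at h5
      rw [← h5]
      refine Finset.sum_congr rfl fun h hh => ?_
      rw [(Finset.mem_filter.1 (Finset.mem_sdiff.1 hh).1).2, mul_one]
    have h4' : ∑ h ∈ I v \ M v, t h * c h = 0 := by
      have h5 := ht3 (v, -1)
      rw [hfib2] at h5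
      rw [← neg_zero, ← h5, ← Finset.sum_neg_distrib]
      refine Finset.sum_congr rfl fun h hh => ?_
      rw [(Finset.mem_filter.1 (Finset.mem_sdiff.1 hh).1).2]; ring
    rw [h1, Finset.sum_union h2, Finset.sum_union h3, h4, h4']; ring
  set Y := X.filter (fun e => t (e, false) * c (e, false) = 1) with hY
  have hYH : Y ×ˢ Finset.univ = H.filter (fun h => t h * c h = 1) := by
    ext ⟨e, b⟩
    simp only [hY, hH, Finset.mem_product, Finset.mem_filter, Finset.mem_univ, and_true]
    refine and_congr_right fun he => ?_
    have := hsa (e, false) (by simp [hH, he])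
    cases b
    · rfl
    · simp only [ha, Bool.not_false] at this
      rw [this]
  have hYdeg : ∀ v, 2 * (edgeDegree ends Y v : ℤ) - edgeDegree ends X v
      = ∑ h ∈ M v, t h * c h := by
    intro v
    rw [← hsv, hdeg, hdeg, hYH, Finset.filter_filter, Finset.card_filter, Finset.card_filter,
      Finset.sum_filter]
    push_cast
    rw [Finset.mul_sum, ← Finset.sum_sub_distrib]
    refine Finset.sum_congr rfl fun h hh => ?_
    rcases hs h hh with h1 | h1 <;> by_cases h2 : f h = v <;> simp [h1, h2]
  have hXdeg : ∀ v, edgeDegree ends X v = 2 * (O v).card := by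
    intro v
    rw [hdeg, hOI, Finset.card_union_of_disjoint (hdisj v), ← hcard]; ring
  have hcases : ∀ v, (Even (O v).card ∧ ∑ h ∈ M v, t h * c h = 0) ∨
      (Odd (O v).card ∧ (∑ h ∈ M v, t h * c h = 2 ∨ ∑ h ∈ M v, t h * c h = -2)) := by
    intro v
    rcases hM v with ⟨h, h'⟩ | ⟨o, ho, i, hi, h, h'⟩
    · left; simp [h, h']
    · right
      have hoi : o ≠ i := fun hoi => Finset.disjoint_left.1 (hdisj v) ho (hoi ▸ hi)
      have h1 := ht3 (v, 0)
      rw [hfib0, h, Finset.sum_pair hoi] at h1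
      have h2 : c o = 1 := (Finset.mem_filter.1 ho).2
      have h3 : c i = -1 := (Finset.mem_filter.1 hi).2
      have h4 := ht1 o (Finset.mem_filter.1 (Finset.mem_filter.1 ho).1).1
      refine ⟨h', ?_⟩
      rw [h, Finset.sum_pair hoi, h2, h3]
      omega
  refine ⟨Y, Finset.filter_subset _ _, ?_, ?_⟩
  · intro v
    have h1 := hYdeg v
    have h2 := hXdeg v
    rcases hcases v with ⟨⟨m, h3⟩, h4⟩ | ⟨⟨m, h3⟩, h4 | h4⟩
    · exact ⟨m, by omega⟩
    · exact ⟨m + 1, by omega⟩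
    · exact ⟨m, by omega⟩
  · intro v
    rw [hYdeg v, abs_le]
    rcases hcases v with ⟨-, h4⟩ | ⟨-, h4 | h4⟩ <;> omega

/-! ### Splitting an even edge set in a given ratio -/

/-- Rounding weights that are multiples of `2⁻ᵐ`: the edges of `A` carry the weight `a / 2ᵐ` and
those of `B` the weight `(a + 1) / 2ᵐ`. One binary digit is removed per step, from the last one up,
by halving the class whose numerator is odd; so the errors form a geometric series. -/
theorem EvenEdges.exists_round {V β : Type*} [DecidableEq β] {ends : β → Bool → V} (m : ℕ) :
    ∀ (a : ℕ) (A B : Finset β), EvenEdges ends A → EvenEdges ends B → Disjoint A B → a < 2 ^ m →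
    ∃ Y ⊆ A ∪ B, EvenEdges ends Y ∧ ∀ v, |(edgeDegree ends Y v : ℝ) -
      (a * edgeDegree ends A v + (a + 1) * edgeDegree ends B v) / 2 ^ m| ≤ 2 * (1 - 1 / 2 ^ m) := by
  induction m with
  | zero =>
    intro a A B hA hB _ ha
    obtain rfl : a = 0 := by simpa using ha
    exact ⟨B, Finset.subset_union_right, hB, fun v => by simp⟩
  | succ m ih =>
    intro a A B hA hB hAB ha
    have hp : (0 : ℝ) < 2 ^ m := by positivity
    have key : ∀ y t u d : ℝ, |y - u / 2 ^ m| ≤ 2 * (1 - 1 / 2 ^ m) → 2 * u - t = d → |d| ≤ 2 →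
        |y - t / 2 ^ (m + 1)| ≤ 2 * (1 - 1 / 2 ^ (m + 1)) := by
      intro y t u d h1 h2 h3
      have h4 : y - t / 2 ^ (m + 1) = (y - u / 2 ^ m) + d / 2 ^ (m + 1) := by
        rw [← h2, pow_succ]; field_simp; ring
      have h5 : |d / 2 ^ (m + 1)| ≤ 2 / 2 ^ (m + 1) := by
        rw [abs_div, abs_of_pos (by positivity : (0 : ℝ) < 2 ^ (m + 1))]
        gcongr
      rw [h4]
      refine (abs_add_le _ _).trans ((add_le_add h1 h5).trans (le_of_eq ?_))
      rw [pow_succ]; field_simp; ring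
    have half : ∀ X Z : Finset β, (∀ v, |2 * (edgeDegree ends Z v : ℤ) - edgeDegree ends X v| ≤ 2) →
        ∀ v, |2 * (edgeDegree ends Z v : ℝ) - edgeDegree ends X v| ≤ 2 := by
      intro X Z h v
      exact_mod_cast h v
    rcases Nat.even_or_odd' a with ⟨c, rfl | rfl⟩
    · obtain ⟨Z, hZB, hZ, hZd⟩ := hB.exists_half
      have hAB' : Disjoint A (B \ Z) := hAB.mono_right Finset.sdiff_subset
      obtain ⟨Y, hY, hYe, hYd⟩ := ih c (A ∪ (B \ Z)) Z (hA.union (hB.sdiff hZ hZB) hAB') hZ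
        (Finset.disjoint_union_left.2 ⟨hAB.mono_right hZB, Finset.sdiff_disjoint⟩)
        (by rw [pow_succ] at ha; omega)
      refine ⟨Y, ?_, hYe, fun v => ?_⟩
      · rwa [Finset.union_assoc, Finset.sdiff_union_of_subset hZB] at hY
      · refine key _ _ _ _ (hYd v) ?_ (half B Z hZd v)
        have h1 : (edgeDegree ends (B \ Z) v : ℝ) + edgeDegree ends Z v = edgeDegree ends B v := by
          exact_mod_cast edgeDegree_sdiff ends hZB v
        rw [edgeDegree_union ends hAB', ← h1]
        push_cast
        ring
    · obtain ⟨Z, hZA, hZ, hZd⟩ := hA.exists_half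
      have hAB' : Disjoint Z B := hAB.mono_left hZA
      obtain ⟨Y, hY, hYe, hYd⟩ := ih c (A \ Z) (Z ∪ B) (hA.sdiff hZ hZA) (hZ.union hB hAB')
        (Finset.disjoint_union_right.2
          ⟨Finset.sdiff_disjoint, hAB.mono_left Finset.sdiff_subset⟩)
        (by rw [pow_succ] at ha; omega)
      refine ⟨Y, ?_, hYe, fun v => ?_⟩
      · rwa [← Finset.union_assoc, Finset.sdiff_union_of_subset hZA] at hY
      · refine key _ _ _ _ (hYd v) ?_ (half A Z hZd v)
        have h1 : (edgeDegree ends (A \ Z) v : ℝ) + edgeDegree ends Z v = edgeDegree ends A v := by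
          exact_mod_cast edgeDegree_sdiff ends hZA v
        rw [edgeDegree_union ends hAB', ← h1]
        push_cast
        ring

/-- An even edge set has an even subset with prescribed proportion of all degrees, up to an error
of two. -/
theorem EvenEdges.exists_ratio {V β : Type*} [DecidableEq β] {ends : β → Bool → V} {X : Finset β}
    (hX : EvenEdges ends X) {ρ : ℝ} (h0 : 0 ≤ ρ) (h1 : ρ ≤ 1) :
    ∃ Y ⊆ X, EvenEdges ends Y ∧
      ∀ v, |(edgeDegree ends Y v : ℝ) - ρ * edgeDegree ends X v| ≤ 2 := by
  rcases h1.eq_or_lt with rfl | h1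
  · exact ⟨X, subset_rfl, hX, fun v => by simp⟩
  -- round down to multiples of `2⁻ᵐ`; one subset serves infinitely many `m`, by finiteness
  have hex : ∀ m : ℕ, ∃ Y : X.powerset, EvenEdges ends Y.1 ∧ ∀ v,
      |(edgeDegree ends Y.1 v : ℝ) - ρ * edgeDegree ends X v| ≤
        2 + edgeDegree ends X v * (1 / 2) ^ m := by
    intro m
    have hp : (0 : ℝ) < 2 ^ m := by positivity
    have hlt : ⌊ρ * 2 ^ m⌋₊ < 2 ^ m := by
      rw [Nat.floor_lt (by positivity)]
      push_cast
      nlinarith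
    obtain ⟨Y, hY, hYe, hYd⟩ := EvenEdges.exists_round (ends := ends) m _ X ∅ hX
      (fun v => by simp [edgeDegree]) (Finset.disjoint_empty_right X) hlt
    refine ⟨⟨Y, by simpa using hY⟩, hYe, fun v => ?_⟩
    have h2 := hYd v
    have h3 : edgeDegree ends (∅ : Finset β) v = 0 := by simp [edgeDegree]
    rw [h3] at h2
    set d : ℝ := (edgeDegree ends X v : ℝ)
    have hd : 0 ≤ d := Nat.cast_nonneg _
    have h4 := Nat.floor_le (by positivity : 0 ≤ ρ * 2 ^ m)
    have h5 := Nat.lt_floor_add_one (ρ * 2 ^ m)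
    set n : ℝ := (⌊ρ * 2 ^ m⌋₊ : ℝ)
    have h6 : |n / 2 ^ m * d - ρ * d| ≤ d * (1 / 2) ^ m := by
      have h7 : n / 2 ^ m * d - ρ * d = -((ρ * 2 ^ m - n) * (d * (1 / 2) ^ m)) := by
        rw [one_div, inv_pow]; field_simp; ring
      rw [h7, abs_neg, abs_of_nonneg (mul_nonneg (by linarith) (by positivity))]
      exact mul_le_of_le_one_left (by positivity) (by linarith)
    have h8 : (n * d + (n + 1) * ((0 : ℕ) : ℝ)) / 2 ^ m = n / 2 ^ m * d := by
      push_cast; ring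
    rw [h8] at h2
    have h9 : 2 * (1 - 1 / 2 ^ m : ℝ) ≤ 2 := by
      have : (0 : ℝ) ≤ 1 / 2 ^ m := by positivity
      linarith
    calc _ = |((edgeDegree ends Y v : ℝ) - n / 2 ^ m * d) + (n / 2 ^ m * d - ρ * d)| := by ring_nf
      _ ≤ _ := (abs_add_le _ _).trans (add_le_add (h2.trans h9) h6)
  choose F hFe hFd using hex
  obtain ⟨Y, hY⟩ := Finite.exists_infinite_fiber F
  have hinf : (F ⁻¹' {Y}).Infinite := Set.infinite_coe_iff.1 hY
  refine ⟨Y.1, Finset.mem_powerset.1 Y.2, ?_, fun v => ?_⟩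
  · obtain ⟨m, hm⟩ := hinf.nonempty
    have := hFe m
    rwa [show F m = Y from hm] at this
  · refine ge_of_tendsto_of_frequently (x := Filter.atTop)
      (f := fun m : ℕ => 2 + (edgeDegree ends X v : ℝ) * (1 / 2) ^ m) ?_ ?_
    · have := ((tendsto_pow_atTop_nhds_zero_of_lt_one (by norm_num : (0 : ℝ) ≤ 1 / 2)
        (by norm_num)).const_mul (edgeDegree ends X v : ℝ)).const_add 2
      simpa using this
    · refine (Nat.frequently_atTop_iff_infinite.2 hinf).mono fun m hm => ?_
      have := hFd m v
      rwa [show F m = Y from hm] at this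

/-! ### Merging groups of colours -/

/-- The colours in `S`, of weights `w`, can share any even edge set `X` in proportion to their
weights. The error allowed for the colour `i` is `6 - 2 * (τ + 1 / w(S)) * w i`, so that a larger
`τ` is a stronger condition; the colours outside `S` get no edges. -/
def Shares {V β ι : Type*} (ends : β → Bool → V) (w : ι → ℝ) (S : Finset ι) (τ : ℝ) : Prop :=
  ∀ X : Finset β, EvenEdges ends X → ∃ Y : ι → Finset β,
    (∀ i j, i ≠ j → Disjoint (Y i) (Y j)) ∧ (∀ i, Y i ⊆ X) ∧ (∀ e ∈ X, ∃ i, e ∈ Y i) ∧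
    (∀ i, EvenEdges ends (Y i)) ∧ (∀ i ∉ S, Y i = ∅) ∧
    ∀ i ∈ S, ∀ v, |(edgeDegree ends (Y i) v : ℝ) - w i / (∑ j ∈ S, w j) * edgeDegree ends X v| ≤
      6 - 2 * (τ + 1 / ∑ j ∈ S, w j) * w i

theorem Shares.mono {V β ι : Type*} {ends : β → Bool → V} {w : ι → ℝ} {S : Finset ι} {τ τ' : ℝ}
    (h : Shares ends w S τ) (hw : ∀ i ∈ S, 0 ≤ w i) (hτ : τ' ≤ τ) : Shares ends w S τ' := by
  intro X hX
  obtain ⟨Y, h1, h2, h3, h4, h5, h6⟩ := h X hX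
  refine ⟨Y, h1, h2, h3, h4, h5, fun i hi v => (h6 i hi v).trans ?_⟩
  have := mul_le_mul_of_nonneg_right hτ (hw i hi)
  linarith

theorem Shares.singleton {V β ι : Type*} [DecidableEq ι] (ends : β → Bool → V) {w : ι → ℝ} {i : ι}
    (hi : 0 < w i) : Shares ends w {i} (2 / w i) := by
  intro X hX
  refine ⟨fun j => if j = i then X else ∅, ?_, ?_, ?_, ?_, ?_, ?_⟩
  · intro j l hjl
    by_cases hj : j = i
    · have : l ≠ i := fun hl => hjl (hj.trans hl.symm)
      simp [this]
    · simp [hj]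
  · intro j
    dsimp only
    split_ifs <;> simp
  · exact fun e he => ⟨i, by simpa using he⟩
  · intro j
    dsimp only
    split_ifs
    · exact hX
    · intro v; simp [edgeDegree]
  · intro j hj
    simp [Finset.mem_singleton.not.1 hj]
  · intro j hj v
    obtain rfl := Finset.mem_singleton.1 hj
    have : (2 / w j + 1 / w j) * w j = 3 := by field_simp; norm_num
    simp only [if_true]
    rw [Finset.sum_singleton, div_self hi.ne', one_mul, sub_self, abs_zero,
      mul_assoc, this]
    norm_num

/-- Two groups of colours are merged by splitting the given edge set in the ratio of their weights;
the error two of that splitting reaches the colour `i` scaled by its share of its group. -/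
theorem Shares.union {V β ι : Type*} [DecidableEq ι] {ends : β → Bool → V}
    {w : ι → ℝ} {S T : Finset ι} {τ : ℝ} (hS : Shares ends w S τ) (hT : Shares ends w T τ)
    (hST : Disjoint S T) (hwS : 0 < ∑ i ∈ S, w i) (hwT : 0 < ∑ i ∈ T, w i)
    (hw : ∀ i ∈ S ∪ T, 0 ≤ w i) :
    Shares ends w (S ∪ T) (τ - 1 / ∑ i ∈ S ∪ T, w i) := by
  classical
  intro X hX
  rw [Finset.sum_union hST]
  set s := ∑ i ∈ S, w i
  set t := ∑ i ∈ T, w i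
  obtain ⟨Z, hZX, hZ, hZd⟩ := hX.exists_ratio (ρ := s / (s + t)) (by positivity)
    ((div_le_one (by positivity)).2 (by linarith))
  have hZd' : ∀ v, |(edgeDegree ends (X \ Z) v : ℝ) - t / (s + t) * edgeDegree ends X v| ≤ 2 := by
    intro v
    have h1 : (edgeDegree ends (X \ Z) v : ℝ) + edgeDegree ends Z v = edgeDegree ends X v := by
      exact_mod_cast edgeDegree_sdiff ends hZX v
    have h2 : (edgeDegree ends (X \ Z) v : ℝ) - t / (s + t) * edgeDegree ends X v
        = -((edgeDegree ends Z v : ℝ) - s / (s + t) * edgeDegree ends X v) := by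
      rw [← h1]; field_simp; ring
    rw [h2, abs_neg]
    exact hZd v
  obtain ⟨Y, h1, h2, h3, h4, h5, h6⟩ := hS Z hZ
  obtain ⟨Y', h1', h2', h3', h4', h5', h6'⟩ := hT (X \ Z) (hX.sdiff hZ hZX)
  have combine : ∀ y z x r u : ℝ, 0 < r → 0 ≤ u → |y - u / r * z| ≤ 6 - 2 * (τ + 1 / r) * u →
      |z - r / (s + t) * x| ≤ 2 →
      |y - u / (s + t) * x| ≤ 6 - 2 * (τ - 1 / (s + t) + 1 / (s + t)) * u := by
    intro y z x r u hr hu ha hb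
    have e1 : y - u / (s + t) * x = (y - u / r * z) + u / r * (z - r / (s + t) * x) := by
      field_simp; ring
    have e2 : |u / r * (z - r / (s + t) * x)| ≤ u / r * 2 := by
      rw [abs_mul, abs_of_nonneg (by positivity : 0 ≤ u / r)]
      gcongr
    rw [e1]
    refine (abs_add_le _ _).trans ((add_le_add ha e2).trans (le_of_eq ?_))
    field_simp
    ring
  have hZdis : Disjoint Z (X \ Z) := Finset.disjoint_sdiff
  refine ⟨fun i => if i ∈ S then Y i else Y' i, ?_, ?_, ?_, ?_, ?_, ?_⟩
  · intro i j hij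
    dsimp only
    split_ifs
    · exact h1 i j hij
    · exact hZdis.mono (h2 i) (h2' j)
    · exact (hZdis.mono (h2 j) (h2' i)).symm
    · exact h1' i j hij
  · intro i
    dsimp only
    split_ifs
    · exact (h2 i).trans hZX
    · exact (h2' i).trans Finset.sdiff_subset
  · intro e he
    by_cases heZ : e ∈ Z
    · obtain ⟨i, hi⟩ := h3 e heZ
      have hiS : i ∈ S := by
        by_contra hiS
        simp [h5 i hiS] at hi
      exact ⟨i, by simpa [hiS] using hi⟩
    · obtain ⟨i, hi⟩ := h3' e (Finset.mem_sdiff.2 ⟨he, heZ⟩)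
      have hiT : i ∈ T := by
        by_contra hiT
        simp [h5' i hiT] at hi
      exact ⟨i, by simpa [Finset.disjoint_right.1 hST hiT] using hi⟩
  · intro i
    dsimp only
    split_ifs
    · exact h4 i
    · exact h4' i
  · intro i hi
    rw [Finset.mem_union, not_or] at hi
    simp [hi.1, h5' i hi.2]
  · intro i hi v
    have hwi := hw i hi
    dsimp only
    split_ifs with hiS
    · exact combine _ _ _ _ _ hwS hwi (h6 i hiS v) (hZd v)
    · have hiT : i ∈ T := (Finset.mem_union.1 hi).resolve_left hiS
      exact combine _ _ _ _ _ hwT hwi (h6' i hiT v) (hZd' v)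

/-- Every finite group of colours of positive weight can be formed by merging with a positive `τ`.
The groups in `𝓕` have `τ = 2 / w(A)`, a property that merging preserves when the two weights differ
by a factor of at most two. When the lightest group of `𝓕` cannot be merged in this way, all others
weigh more than twice as much, and it is added to the group `L`, which has the weaker property
that `τ` is at least `1 / w(L)` and at least `1 / w(A)` for all `A` in `𝓕`. -/
theorem Shares.exists_biUnion {V β ι : Type*} [DecidableEq ι] {ends : β → Bool → V} {w : ι → ℝ}
    (n : ℕ) : ∀ (𝓕 : Finset (Finset ι)) (L : Finset ι), 𝓕.card = n →
    (∀ A ∈ 𝓕, ∀ B ∈ 𝓕, A ≠ B → Disjoint A B) → (∀ A ∈ 𝓕, Disjoint A L) →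
    (∀ A ∈ 𝓕, ∀ i ∈ A, 0 < w i) → (∀ i ∈ L, 0 < w i) →
    (∀ A ∈ 𝓕, A.Nonempty ∧ Shares ends w A (2 / ∑ i ∈ A, w i)) →
    (L = ∅ ∧ 𝓕.Nonempty ∨ L.Nonempty ∧ ∃ τ, Shares ends w L τ ∧ 1 / ∑ i ∈ L, w i ≤ τ ∧
      ∀ A ∈ 𝓕, 1 / ∑ i ∈ A, w i ≤ τ) →
    ∃ τ > 0, Shares ends w (L ∪ 𝓕.biUnion id) τ := by
  induction n using Nat.strong_induction_on with
  | _ n ih =>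
  intro 𝓕 L hn hdis hdisL hwF hwL hF hL
  rcases 𝓕.eq_empty_or_nonempty with rfl | hne
  · obtain ⟨-, h⟩ | ⟨hLne, τ, hτ, h1, -⟩ := hL
    · exact absurd h Finset.not_nonempty_empty
    · exact ⟨τ, (one_div_pos.2 (Finset.sum_pos hwL hLne)).trans_le h1, by simpa using hτ⟩
  obtain ⟨A, hA, hAmin⟩ := 𝓕.exists_min_image (fun A => ∑ i ∈ A, w i) hne
  have hpos : ∀ B ∈ 𝓕, 0 < ∑ i ∈ B, w i := fun B hB => Finset.sum_pos (hwF B hB) (hF B hB).1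
  have hApos := hpos A hA
  by_cases hex : ∃ B ∈ 𝓕, B ≠ A ∧ ∑ i ∈ B, w i ≤ 2 * ∑ i ∈ A, w i
  · obtain ⟨B, hB, hBA, hB2⟩ := hex
    have hBpos := hpos B hB
    have hAB : Disjoint A B := hdis A hA B hB hBA.symm
    have hle := hAmin B hB
    have hsum := Finset.sum_union (f := w) hAB
    have hwAB : ∀ i ∈ A ∪ B, 0 < w i := fun i hi =>
      (Finset.mem_union.1 hi).elim (hwF A hA i) (hwF B hB i)
    have hshare : Shares ends w (A ∪ B) (2 / ∑ i ∈ A ∪ B, w i) := by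
      refine Shares.mono (Shares.union (τ := 2 / ∑ i ∈ B, w i) ?_ (hF B hB).2 hAB hApos hBpos
        fun i hi => (hwAB i hi).le) (fun i hi => (hwAB i hi).le) ?_
      · refine (hF A hA).2.mono (fun i hi => (hwF A hA i hi).le) ?_
        gcongr
      · rw [hsum, le_sub_iff_add_le, ← add_div, div_le_div_iff₀ (by positivity) hBpos]
        linarith
    have hmem : ∀ C ∈ insert (A ∪ B) ((𝓕.erase A).erase B),
        C = A ∪ B ∨ C ∈ 𝓕 ∧ C ≠ A ∧ C ≠ B := by
      intro C hC
      simp only [Finset.mem_insert, Finset.mem_erase] at hC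
      tauto
    have hdisAB : ∀ C ∈ 𝓕, C ≠ A → C ≠ B → Disjoint C (A ∪ B) := fun C hC h1 h2 =>
      Finset.disjoint_union_right.2 ⟨hdis C hC A hA h1, hdis C hC B hB h2⟩
    have hcard : (insert (A ∪ B) ((𝓕.erase A).erase B)).card < n := by
      refine (Finset.card_insert_le _ _).trans_lt ?_
      have h1 := Finset.card_erase_add_one hA
      have h2 := Finset.card_erase_add_one (Finset.mem_erase.2 ⟨hBA, hB⟩)
      omega
    refine Exists.imp ?_
      (ih _ hcard (insert (A ∪ B) ((𝓕.erase A).erase B)) L rfl ?_ ?_ ?_ hwL ?_ ?_)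
    · refine fun τ ⟨hτ, hs⟩ => ⟨hτ, ?_⟩
      convert hs using 2
      ext i
      simp only [Finset.mem_biUnion, id, Finset.mem_insert, Finset.mem_erase]
      constructor
      · rintro ⟨C, hC, hi⟩
        by_cases h1 : C = A
        · exact ⟨A ∪ B, Or.inl rfl, Finset.mem_union_left _ (h1 ▸ hi)⟩
        by_cases h2 : C = B
        · exact ⟨A ∪ B, Or.inl rfl, Finset.mem_union_right _ (h2 ▸ hi)⟩
        exact ⟨C, Or.inr ⟨h2, h1, hC⟩, hi⟩
      · rintro ⟨C, rfl | hC, hi⟩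
        · rcases Finset.mem_union.1 hi with hi | hi
          · exact ⟨A, hA, hi⟩
          · exact ⟨B, hB, hi⟩
        · exact ⟨C, hC.2.2, hi⟩
    · intro C hC D hD hCD
      rcases hmem C hC with rfl | ⟨hC, h1, h2⟩ <;> rcases hmem D hD with rfl | ⟨hD, h3, h4⟩
      · exact absurd rfl hCD
      · exact (hdisAB D hD h3 h4).symm
      · exact hdisAB C hC h1 h2
      · exact hdis C hC D hD hCD
    · intro C hC
      rcases hmem C hC with rfl | ⟨hC, -, -⟩
      · exact Finset.disjoint_union_left.2 ⟨hdisL A hA, hdisL B hB⟩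
      · exact hdisL C hC
    · intro C hC
      rcases hmem C hC with rfl | ⟨hC, -, -⟩
      · exact hwAB
      · exact hwF C hC
    · intro C hC
      rcases hmem C hC with rfl | ⟨hC, -, -⟩
      · exact ⟨(hF A hA).1.inl, hshare⟩
      · exact hF C hC
    · refine hL.imp (fun h => ⟨h.1, Finset.insert_nonempty _ _⟩) ?_
      rintro ⟨hLne, τ, hτ, h1, h2⟩
      refine ⟨hLne, τ, hτ, h1, fun C hC => ?_⟩
      rcases hmem C hC with rfl | ⟨hC, -, -⟩
      · rw [hsum]
        exact (one_div_le_one_div_of_le hApos (by linarith)).trans (h2 A hA)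
      · exact h2 C hC
  · push Not at hex
    have hcard : (𝓕.erase A).card < n := by
      have h1 := Finset.card_erase_add_one hA
      omega
    have hwLA : ∀ i ∈ L ∪ A, 0 < w i := fun i hi =>
      (Finset.mem_union.1 hi).elim (hwL i) (hwF A hA i)
    refine Exists.imp ?_ (ih _ hcard (𝓕.erase A) (L ∪ A) rfl ?_ ?_ ?_ hwLA ?_ ?_)
    · refine fun τ ⟨hτ, hs⟩ => ⟨hτ, ?_⟩
      rwa [← Finset.insert_erase hA, Finset.biUnion_insert, id, ← Finset.union_assoc]
    · exact fun C hC D hD => hdis C (Finset.mem_of_mem_erase hC) D (Finset.mem_of_mem_erase hD)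
    · intro C hC
      have hC' := Finset.mem_erase.1 hC
      exact Finset.disjoint_union_right.2 ⟨hdisL C hC'.2, hdis C hC'.2 A hA hC'.1⟩
    · exact fun C hC => hwF C (Finset.mem_of_mem_erase hC)
    · exact fun C hC => hF C (Finset.mem_of_mem_erase hC)
    · right
      refine ⟨(hF A hA).1.inr, ?_⟩
      obtain ⟨rfl, -⟩ | ⟨hLne, τ, hτ, h1, h2⟩ := hL
      · rw [Finset.empty_union]
        refine ⟨2 / ∑ i ∈ A, w i, (hF A hA).2, ?_, fun C hC => ?_⟩
        · gcongr; norm_num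
        · have h3 := hAmin C (Finset.mem_of_mem_erase hC)
          have h4 := hpos C (Finset.mem_of_mem_erase hC)
          gcongr; norm_num
      · have hLpos : 0 < ∑ i ∈ L, w i := Finset.sum_pos hwL hLne
        have h3 := h2 A hA
        have hsum := Finset.sum_union (f := w) (hdisL A hA).symm
        have hshare := Shares.union (τ := min τ (2 / ∑ i ∈ A, w i))
          (hτ.mono (fun i hi => (hwL i hi).le) (min_le_left _ _))
          ((hF A hA).2.mono (fun i hi => (hwF A hA i hi).le) (min_le_right _ _))
          (hdisL A hA).symm hLpos hApos (fun i hi => (hwLA i hi).le)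
        refine ⟨_, hshare, ?_, fun C hC => ?_⟩
        · rw [hsum, le_sub_iff_add_le, ← add_div]
          set x := ∑ i ∈ A, w i
          set l := ∑ i ∈ L, w i
          refine le_min ?_ ?_
          · rcases le_total l x with h | h
            · refine le_trans ?_ h1
              rw [div_le_div_iff₀ (by positivity) hLpos]; linarith
            · refine le_trans ?_ h3
              rw [div_le_div_iff₀ (by positivity) hApos]; linarith
          · rw [div_le_div_iff₀ (by positivity) hApos]; linarith
        · have hC' := Finset.mem_erase.1 hC
          have h4 := hex C hC'.2 hC'.1
          refine (one_div_le_one_div_of_le (by positivity) h4.le).trans ?_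
          rw [hsum, le_sub_iff_add_le]
          set x := ∑ i ∈ A, w i
          set l := ∑ i ∈ L, w i
          refine le_min ?_ ?_
          · rcases le_total l x with h | h
            · refine le_trans ?_ h1
              have e1 : 1 / (2 * x) ≤ 1 / (2 * l) := by gcongr
              have e2 : 1 / (l + x) ≤ 1 / (2 * l) := by gcongr; linarith
              have e3 : 1 / (2 * l) + 1 / (2 * l) = 1 / l := by field_simp; norm_num
              linarith
            · refine le_trans ?_ h3
              have e2 : 1 / (l + x) ≤ 1 / (2 * x) := by gcongr; linarith
              have e3 : 1 / (2 * x) + 1 / (2 * x) = 1 / x := by field_simp; norm_num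
              linarith
          · have e1 : 1 / (2 * x) ≤ 1 / x := by gcongr; linarith
            have e2 : 1 / (l + x) ≤ 1 / x := by gcongr; linarith
            have e3 : 1 / x + 1 / x = 2 / x := by ring
            linarith

theorem Shares.exists_pos {V β ι : Type*} (ends : β → Bool → V) {w : ι → ℝ}
    {S : Finset ι} (hS : S.Nonempty) (hw : ∀ i ∈ S, 0 < w i) : ∃ τ > 0, Shares ends w S τ := by
  classical
  obtain ⟨τ, hτ, h⟩ := Shares.exists_biUnion (ends := ends) (w := w) _ (S.image fun i => {i}) ∅ rfl
    (by
      simp only [Finset.mem_image]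
      rintro _ ⟨i, -, rfl⟩ _ ⟨j, -, rfl⟩ hij
      exact Finset.disjoint_singleton.2 fun h => hij (by rw [h]))
    (fun _ _ => Finset.disjoint_empty_right _)
    (by
      simp only [Finset.mem_image]
      rintro _ ⟨i, hi, rfl⟩ j hj
      obtain rfl := Finset.mem_singleton.1 hj
      exact hw _ hi)
    (by simp)
    (by
      simp only [Finset.mem_image]
      rintro _ ⟨i, hi, rfl⟩
      refine ⟨Finset.singleton_nonempty i, ?_⟩
      rw [Finset.sum_singleton]
      exact Shares.singleton ends (hw i hi))
    (Or.inl ⟨rfl, hS.image _⟩)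
  refine ⟨τ, hτ, ?_⟩
  convert h
  ext i
  simp

/-! ### Degrees in a multigraph -/

/-- The degree of `v` in a restriction of a multigraph, in terms of ends chosen for its edges. The
ends are taken in `Option α`, so that edges outside `G` have ends even if `α` is empty. -/
theorem Graph.edgeDegree_eq_degree_restrict {α β : Type*} (G : Graph α β)
    {ends : β → Bool → Option α}
    (hends : ∀ e ∈ G.edgeSet, ∃ x y, G.IsLink e x y ∧ ends e false = some x ∧ ends e true = some y)
    {X : Finset β} (hX : ↑X ⊆ G.edgeSet) (v : α) :
    edgeDegree ends X (some v) = (G.restrict ↑X).degree v := by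
  classical
  have h1 : {e | (G.restrict ↑X).IsNonloopAt e v} = ↑(X.filter fun e => G.IsNonloopAt e v) := by
    ext e
    rw [Finset.mem_coe, Finset.mem_filter]
    exact ⟨fun ⟨y, hy, he, h⟩ => ⟨he, y, hy, h⟩, fun ⟨he, y, hy, h⟩ => ⟨y, hy, he, h⟩⟩
  have h2 : {e | (G.restrict ↑X).IsLoopAt e v} = ↑(X.filter fun e => G.IsLoopAt e v) := by
    ext e
    rw [Finset.mem_coe, Finset.mem_filter]
    exact Iff.rfl
  rw [Graph.degree, h1, h2, Set.ncard_coe_finset, Set.ncard_coe_finset, Finset.card_filter,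
    Finset.card_filter, Finset.mul_sum, ← Finset.sum_add_distrib, edgeDegree]
  refine Finset.sum_congr rfl fun e he => ?_
  obtain ⟨x, y, hxy, hx, hy⟩ := hends e (hX he)
  have h3 : G.IsLoopAt e v ↔ x = v ∧ y = v := by
    constructor
    · intro h
      exact ⟨(h.eq_of_inc hxy.inc_left).symm, (h.eq_of_inc hxy.inc_right).symm⟩
    · rintro ⟨rfl, rfl⟩
      exact hxy
  have h4 : G.IsNonloopAt e v ↔ (x = v ∨ y = v) ∧ ¬ (x = v ∧ y = v) := by
    rw [Graph.isNonloopAt_iff_inc_not_isLoopAt, h3]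
    refine and_congr_left fun _ => ⟨fun h => ?_, ?_⟩
    · rcases h.eq_or_eq_of_isLink hxy with h | h
      · exact Or.inl h.symm
      · exact Or.inr h.symm
    · rintro (rfl | rfl)
      · exact hxy.inc_left
      · exact hxy.inc_right
  simp only [Fintype.sum_bool, hx, hy, Option.some.injEq, h3, h4]
  by_cases h5 : x = v <;> by_cases h6 : y = v <;> simp [h5, h6]

theorem mainTheorem11 {α β : Type*} (G : Graph α β)
    (hV : G.vertexSet.Finite) (hE : G.edgeSet.Finite)
    (hG : G.HasEvenDegrees)
    (k : ℕ) (ε : Fin k → ℝ) (hε : ∀ i, 0 ≤ ε i) (hsum : ∑ i, ε i = 1) :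
    ∃ H : Fin k → Graph α β,
      G.IsEdgeDecomposition H ∧
      (∀ i, (H i).IsEvenFactor G) ∧
      ∀ i, ∀ v ∈ (H i).vertexSet,
        |((H i).degree v : ℝ) - ε i * (G.degree v : ℝ)| < 6 := by
  classical
  have hends : ∀ e, ∃ p : Bool → Option α, e ∈ G.edgeSet →
      ∃ x y, G.IsLink e x y ∧ p false = some x ∧ p true = some y := by
    intro e
    by_cases he : e ∈ G.edgeSet
    · obtain ⟨x, y, hxy⟩ := G.exists_isLink_of_mem_edgeSet he
      exact ⟨fun b => if b then some y else some x, fun _ => ⟨x, y, hxy, by simp⟩⟩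
    · exact ⟨fun _ => none, fun h => absurd h he⟩
  choose ends hends using hends
  set X := hE.toFinset
  have hXE : (X : Set β) = G.edgeSet := hE.coe_toFinset
  have hdeg : ∀ Y ⊆ X, ∀ v, edgeDegree ends Y (some v) = (G.restrict ↑Y).degree v := fun Y hY v =>
    G.edgeDegree_eq_degree_restrict hends
      ((Finset.coe_subset.2 hY).trans hXE.subset) v
  have hXG : G.restrict ↑X = G := by
    rw [hXE]
    simp
  have hXeven : EvenEdges ends X := by
    rintro (_ | v)
    · have : edgeDegree ends X none = 0 := by
        refine Finset.sum_eq_zero fun e he => ?_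
        obtain ⟨x, y, -, hx, hy⟩ := hends e (hXE.subset he)
        simp [hx, hy]
      simp [this]
    · rw [hdeg X subset_rfl, hXG]
      by_cases hv : v ∈ G.vertexSet
      · exact hG v hv
      · have h1 : {e | G.IsNonloopAt e v} = ∅ :=
          Set.eq_empty_of_forall_notMem fun e he => hv he.vertex_mem
        have h2 : {e | G.IsLoopAt e v} = ∅ :=
          Set.eq_empty_of_forall_notMem fun e he => hv he.vertex_mem
        simp [Graph.degree, h1, h2]
  set S := Finset.univ.filter fun i => 0 < ε i
  have hS0 : ∀ i ∉ S, ε i = 0 := fun i hi =>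
    le_antisymm (not_lt.1 fun h => hi (by simp [S, h])) (hε i)
  have hSsum : ∑ i ∈ S, ε i = 1 := by
    rw [← hsum]
    exact Finset.sum_subset (Finset.subset_univ _) fun i _ hi => hS0 i hi
  have hSpos : ∀ i ∈ S, 0 < ε i := fun i hi => (Finset.mem_filter.1 hi).2
  have hSne : S.Nonempty := by
    rw [Finset.nonempty_iff_ne_empty]
    intro h
    simp [h] at hSsum
  obtain ⟨τ, hτ, hshare⟩ := Shares.exists_pos ends hSne hSpos
  obtain ⟨Y, h1, h2, h3, h4, h5, h6⟩ := hshare X hXeven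
  refine ⟨fun i => G.restrict ↑(Y i), ⟨fun i => G.restrict_le, ?_, ?_⟩, fun i => ⟨⟨?_, rfl⟩, ?_⟩, ?_⟩
  · intro i j hij
    exact (Finset.disjoint_coe.2 (h1 i j hij)).mono Set.inter_subset_right Set.inter_subset_right
  · ext e
    simp only [Graph.restrict, Set.mem_iUnion, Set.mem_inter_iff, exists_and_left]
    refine ⟨fun h => h.1, fun h => ⟨h, ?_⟩⟩
    exact h3 e (hE.mem_toFinset.2 h)
  · exact G.restrict_le
  · intro v _
    rw [← hdeg _ (h2 i)]
    exact h4 i _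
  · intro i v _
    rw [← hdeg _ (h2 i)]
    by_cases hi : i ∈ S
    · have h7 := h6 i hi (some v)
      rw [hSsum, div_one, hdeg X subset_rfl, hXG] at h7
      refine h7.trans_lt ?_
      have := mul_pos (by linarith : 0 < τ + 1 / 1) (hSpos i hi)
      linarith
    · simp [hS0 i hi, h5 i hi, edgeDegree]
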